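/- Let $\mathscr{M}$ be the Gromov--Hausdorff space, i.e. the set of isometry classes of non-empty compact metric spaces with the Gromov--Hausdorff distance $d_{GH}$. Call a metric space geodesic if for any two points $x,y$ there is a map $\gamma:[0,1]\to X$ with $\gamma(0)=x$, $\gamma(1)=y$ and $d(\gamma(s),\gamma(t))=|s-t|\,d(x,y)$ for all $s,t\in[0,1]$; call it $\mathrm{CAT}(0)$ if it is geodesic and, for every geodesic triangle $\triangle$ and all $x,y\in\triangle$, $d(x,y)\le \|\overline{x}-\overline{y}\|$ whenever $\overline{x},\overline{y}$ are comparison points of $x,y$ in a comparison triangle of $\triangle$ in the Euclidean plane $\mathbb{R}^2$. Let $\mathscr{C},\mathscr{P},\mathscr{G},\mathscr{Z}\subset\mathscr{M}$ be the subsets of all compact metric spaces that are connected, path-connected, geodesic, and $\mathrm{CAT}(0)$, respectively. Theorem. Let $n\ge 1$ be an integer, let $H$ be a compact metrizable space, and let $v_1,\dots,v_{n+1}$ be $n+1$ distinct points of $H$. Let $\mathscr{S}$ be any one of $\mathscr{C}$, $\mathscr{P}$, $\mathscr{G}$, $\mathscr{Z}$, and let $(X_1,d_1),\dots,(X_{n+1},d_{n+1})$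 be elements of $\mathscr{S}$ with $d_{GH}\big((X_i,d_i),(X_j,d_j)\big)>0$ for all $i\ne j$. Then there is a topological embedding $\Phi:H\to\mathscr{S}$ (with $\mathscr{S}$ carrying the topology induced by $d_{GH}$) such that $\Phi(v_i)=(X_i,d_i)$ for all $i=1,\dots,n+1$. -/

import Mathlib

open Topology TopologicalSpace GromovHausdorff

namespace Continua

/-- `γ : [0, 1] → X` is a geodesic from `x` to `y`. -/
def IsGeodesic {X : Type*} [MetricSpace X] (γ : unitInterval → X) (x y : X) : Prop :=
  γ 0 = x ∧ γ 1 = y ∧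
    ∀ s t : unitInterval, dist (γ s) (γ t) = |(s : ℝ) - (t : ℝ)| * dist x y

/-- A geodesic space: any two points are joined by a geodesic. -/
def IsGeodesicSpace (X : Type*) [MetricSpace X] : Prop :=
  ∀ x y : X, ∃ γ : unitInterval → X, IsGeodesic γ x y

/-- A geodesic triangle: three vertices, and for each `i : Fin 3` (indices taken cyclically)
a geodesic side from vertex `i` to vertex `i + 1`. -/
structure GeodesicTriangle (X : Type*) [MetricSpace X] where
  vertex : Fin 3 → X
  side : Fin 3 → unitInterval → X
  isGeodesic_side : ∀ i, IsGeodesic (side i) (vertex i) (vertex (i + 1))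

/-- The points `w 0, w 1, w 2` of the Euclidean plane are the vertices of a comparison triangle
for `T`: its sides have the same lengths as those of `T`. -/
def GeodesicTriangle.IsComparisonTriangle {X : Type*} [MetricSpace X] (T : GeodesicTriangle X)
    (w : Fin 3 → EuclideanSpace ℝ (Fin 2)) : Prop :=
  ∀ i, dist (w i) (w (i + 1)) = dist (T.vertex i) (T.vertex (i + 1))

/-- `x'` is the comparison point, on the `i`-th side of the comparison triangle with vertices `w`,
of the point `x` on the `i`-th side of `T`. -/
def GeodesicTriangle.IsComparisonPoint {X : Type*} [MetricSpace X] (T : GeodesicTriangle X)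
    (w : Fin 3 → EuclideanSpace ℝ (Fin 2)) (i : Fin 3) (x : X)
    (x' : EuclideanSpace ℝ (Fin 2)) : Prop :=
  x ∈ Set.range (T.side i) ∧ x' ∈ segment ℝ (w i) (w (i + 1)) ∧
    dist (w i) x' = dist (T.vertex i) x

/-- A CAT(0) space: a geodesic space all of whose geodesic triangles are at least as thin as
their Euclidean comparison triangles. -/
def IsCAT0Space (X : Type*) [MetricSpace X] : Prop :=
  IsGeodesicSpace X ∧
    ∀ (T : GeodesicTriangle X) (w : Fin 3 → EuclideanSpace ℝ (Fin 2)),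
      T.IsComparisonTriangle w →
      ∀ (i j : Fin 3) (x y : X) (x' y' : EuclideanSpace ℝ (Fin 2)),
        T.IsComparisonPoint w i x x' → T.IsComparisonPoint w j y y' →
        dist x y ≤ dist x' y'

/-- Isometry classes of non-empty compact metric spaces that are connected. -/
def connectedSpaces : Set GHSpace := {p | ConnectedSpace p.Rep}

/-- Isometry classes of non-empty compact metric spaces that are path-connected. -/
def pathConnectedSpaces : Set GHSpace := {p | PathConnectedSpace p.Rep}

/-- Isometry classes of non-empty compact metric spaces that are geodesic. -/
def geodesicSpaces : Set GHSpace := {p | IsGeodesicSpace p.Rep}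

/-- Isometry classes of non-empty compact metric spaces that are CAT(0). -/
def cat0Spaces : Set GHSpace := {p | IsCAT0Space p.Rep}

end Continua

/-!
The embedding sends `h` to a wedge (one-point union) `F h` of compact spaces: the given spaces
`X i`, rescaled by factors `l i h` that are continuous in `h` and satisfy `l i (v j) = δ i j`, and,
for each level `k`, a number `m k` of intervals of length `w k h`. The lengths are of order `4⁻ᵏ`,
up to a factor that depends on `h` and vanishes exactly at the points `v i`. So `F (v i) = X i`.

* All four classes are closed under rescaling and under compact wedges, and contain the interval
  (`IsScaledWedge.mem_of_forall_mem`, `toGHSpace_unitInterval_mem`). For CAT(0) this goes through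
  an equivalent condition, a Stewart inequality between one point and one geodesic
  (`isCAT0Space_iff_hasStewartGeodesics`, `IsScaledWedge.hasStewartGeodesics`).
* `F` is continuous, because the distance functions of two wedges of the same pieces differ by at
  most the differences of their scaling factors (`IsScaledWedge.ghDist_le`).
* `F` is injective. The number `m k` is chosen larger than the number of points at mutual distance
  `8⁻ᵏ` that fit in the spaces `X i` and in the intervals of the levels before `k`. The `m k`
  endpoints at level `k` are at mutual distance `2 * w k h`, while `F h` does not contain `m k`
  points whose mutual distances are at least `r`, for any `r ≥ 8⁻ᵏ` with `r > 2 * w k h`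
  (`IsScaledWedge.card_le_of_separated`). If `h` is none of the `v i`, then `8⁻ᵏ ≤ 2 * w k h` for
  all large `k`, so the isometry class of `F h` determines `w k h` for these `k`; and the functions
  `w k` are such that this determines `h` (`exists_interval_lengths`).

A continuous injection of a compact space into a Hausdorff space is an embedding.
-/

namespace Continua

/-! ### CAT(0) spaces and Stewart's inequality -/

/-- A form of the CAT(0) condition that only compares a point with the points of one geodesic:
any two points are joined by some geodesic along which the squared distance to every point is at
most what Stewart's theorem gives in the Euclidean plane. Unlike comparison of triangles, it
passes easily to wedges. -/
def HasStewartGeodesics (X : Type*) [MetricSpace X] : Prop :=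
  ∀ x y : X, ∃ γ : unitInterval → X, IsGeodesic γ x y ∧ ∀ (p : X) (t : unitInterval),
    dist p (γ t) ^ 2 ≤ (1 - t) * dist p x ^ 2 + t * dist p y ^ 2 - t * (1 - t) * dist x y ^ 2

namespace IsGeodesic

variable {X : Type*} [MetricSpace X] {γ : unitInterval → X} {x y : X}

theorem dist_left (h : IsGeodesic γ x y) (t : unitInterval) :
    dist x (γ t) = t * dist x y := by
  have h1 := h.2.2 0 t
  rw [h.1] at h1
  simpa [abs_of_nonneg t.2.1] using h1

theorem dist_right (h : IsGeodesic γ x y) (t : unitInterval) :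
    dist (γ t) y = (1 - t) * dist x y := by
  have h1 := h.2.2 t 1
  rw [h.2.1] at h1
  rw [h1, abs_sub_comm, Set.Icc.coe_one, abs_of_nonneg (sub_nonneg.2 t.2.2)]

theorem comp_isometryEquiv {Y : Type*} [MetricSpace Y] (h : IsGeodesic γ x y) (e : X ≃ᵢ Y) :
    IsGeodesic (e ∘ γ) (e x) (e y) := by
  refine ⟨congrArg e h.1, congrArg e h.2.1, fun s t => ?_⟩
  simp only [Function.comp_apply, e.dist_eq]
  exact h.2.2 s t

/-- Two geodesics that meet at a point between `x` and `y` join up to a geodesic from `x` to `y`;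
the last clause gives the positions on the two parts of a point at parameter `t`. -/
theorem exists_concat {m : X} {γ₁ γ₂ : unitInterval → X} (h₁ : IsGeodesic γ₁ x m)
    (h₂ : IsGeodesic γ₂ m y) (hm : dist x m + dist m y = dist x y) :
    ∃ γ, IsGeodesic γ x y ∧ ∀ t : unitInterval,
      (∃ s : unitInterval, γ t = γ₁ s ∧ s * dist x m = t * dist x y) ∨
      (∃ s : unitInterval, γ t = γ₂ s ∧ dist x m + s * dist m y = t * dist x y) := by
  have hA : 0 ≤ dist x m := dist_nonneg
  have hB : 0 ≤ dist m y := dist_nonneg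
  have key : ∀ t : unitInterval, ∃ z : X,
      (∃ s : unitInterval, z = γ₁ s ∧ s * dist x m = t * dist x y) ∨
      (∃ s : unitInterval, z = γ₂ s ∧ dist x m + s * dist m y = t * dist x y) := by
    intro t
    have ht0 := t.2.1
    have ht1 := t.2.2
    rcases le_or_gt (t * dist x y) (dist x m) with h | h
    · rcases hA.eq_or_lt with h0 | h0
      · refine ⟨γ₁ 0, Or.inl ⟨0, rfl, ?_⟩⟩
        have : 0 ≤ t * dist x y := by positivity
        simp only [Set.Icc.coe_zero, zero_mul]
        linarith
      · refine ⟨_, Or.inl ⟨⟨t * dist x y / dist x m, by positivity, ?_⟩, rfl, ?_⟩⟩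
        · exact (div_le_one h0).2 h
        · exact div_mul_cancel₀ _ h0.ne'
    · have h3 : t * dist x y ≤ dist x y := mul_le_of_le_one_left dist_nonneg ht1
      have h0 : 0 < dist m y := by linarith
      refine ⟨_, Or.inr ⟨⟨(t * dist x y - dist x m) / dist m y, ?_, ?_⟩, rfl, ?_⟩⟩
      · exact div_nonneg (by linarith) hB
      · exact (div_le_one h0).2 (by linarith)
      · simp only [div_mul_cancel₀ _ h0.ne']
        ring
  choose γ hγ using key
  have hl : ∀ t, dist x (γ t) ≤ t * dist x y := by
    intro t
    rcases hγ t with ⟨s, hs, h⟩ | ⟨s, hs, h⟩ <;> rw [hs, ← h]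
    · exact (h₁.dist_left s).le
    · rw [← h₂.dist_left s]
      exact dist_triangle _ _ _
  have hr : ∀ t, dist (γ t) y ≤ (1 - t) * dist x y := by
    intro t
    rcases hγ t with ⟨s, hs, h⟩ | ⟨s, hs, h⟩ <;> rw [hs]
    · have := h₁.dist_right s
      have := dist_triangle (γ₁ s) m y
      linarith
    · have := h₂.dist_right s
      linarith
  -- It suffices to bound distances from above: the lower bounds then follow from the triangle
  -- inequality between `x` and `y`.
  have hu : ∀ s t : unitInterval, (s : ℝ) ≤ t → dist (γ s) (γ t) ≤ (t - s) * dist x y := by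
    intro s t hst
    have hmul : (s : ℝ) * dist x y ≤ t * dist x y := mul_le_mul_of_nonneg_right hst dist_nonneg
    rcases hγ s with ⟨a, ha, h⟩ | ⟨a, ha, h⟩ <;> rcases hγ t with ⟨b, hb, h'⟩ | ⟨b, hb, h'⟩ <;>
      rw [ha, hb]
    · rw [h₁.2.2, ← abs_of_nonneg hA, ← abs_mul, abs_le]
      constructor <;> linarith
    · have h5 := h₁.dist_right a
      have h6 := h₂.dist_left b
      have := dist_triangle (γ₁ a) m (γ₂ b)
      linarith
    · have ha0 : 0 ≤ a * dist m y := mul_nonneg a.2.1 hB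
      have hb1 : b * dist x m ≤ dist x m := mul_le_of_le_one_left hA b.2.2
      have h5 := h₁.dist_right b
      have h6 := h₂.dist_left a
      have := dist_triangle_left (γ₂ a) (γ₁ b) m
      rw [dist_comm m (γ₁ b)] at this
      linarith
    · rw [h₂.2.2, ← abs_of_nonneg hB, ← abs_mul, abs_le]
      constructor <;> linarith
  have hd : ∀ s t : unitInterval, (s : ℝ) ≤ t → dist (γ s) (γ t) = (t - s) * dist x y := by
    intro s t hst
    refine (hu s t hst).antisymm ?_
    have h5 := hl s
    have h6 := hr t
    have := dist_triangle4 x (γ s) (γ t) y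
    linarith
  refine ⟨γ, ⟨?_, ?_, fun s t => ?_⟩, hγ⟩
  · have := hl 0
    simp only [Set.Icc.coe_zero, zero_mul] at this
    exact (dist_le_zero.1 this).symm
  · have := hr 1
    simp only [Set.Icc.coe_one, sub_self, zero_mul] at this
    exact dist_le_zero.1 this
  · rcases le_total (s : ℝ) t with h | h
    · rw [hd s t h, abs_sub_comm, abs_of_nonneg (sub_nonneg.2 h)]
    · rw [dist_comm, hd t s h, abs_of_nonneg (sub_nonneg.2 h)]

end IsGeodesic

/-- Stewart's theorem. -/
theorem dist_lineMap_sq {E : Type*} [NormedAddCommGroup E] [InnerProductSpace ℝ E]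
    (p a b : E) (t : ℝ) :
    dist p (AffineMap.lineMap a b t) ^ 2 =
      (1 - t) * dist p a ^ 2 + t * dist p b ^ 2 - t * (1 - t) * dist a b ^ 2 := by
  have h1 : p - AffineMap.lineMap a b t = (1 - t) • (p - a) + t • (p - b) := by
    rw [AffineMap.lineMap_apply_module]
    module
  have h2 : a - b = (p - b) - (p - a) := by abel
  simp only [dist_eq_norm]
  rw [h1, h2, norm_add_sq_real, norm_sub_sq_real (p - b) (p - a), norm_smul, norm_smul, inner_smul_left,
    inner_smul_right, mul_pow, mul_pow, Real.norm_eq_abs, Real.norm_eq_abs, sq_abs, sq_abs,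
    real_inner_comm]
  simp only [conj_trivial]
  ring

theorem exists_euclidean_triangle {a b c : ℝ} (ha : 0 ≤ a) (hb : 0 ≤ b) (hc : 0 ≤ c)
    (h₁ : a ≤ b + c) (h₂ : b ≤ c + a) (h₃ : c ≤ a + b) :
    ∃ w₀ w₁ w₂ : EuclideanSpace ℝ (Fin 2), dist w₀ w₁ = a ∧ dist w₁ w₂ = b ∧ dist w₂ w₀ = c := by
  rcases ha.eq_or_lt with rfl | ha'
  · have : b = c := by linarith
    subst this
    refine ⟨!₂[0, 0], !₂[0, 0], !₂[b, 0], ?_, ?_, ?_⟩ <;>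
      simp [EuclideanSpace.dist_eq, Real.dist_eq, Real.sqrt_sq_eq_abs, abs_of_nonneg hb]
  · -- The foot of the altitude from the third vertex has abscissa `u`, by the law of cosines.
    set u : ℝ := (a ^ 2 + c ^ 2 - b ^ 2) / (2 * a) with hu
    have hu' : 2 * a * u = a ^ 2 + c ^ 2 - b ^ 2 := by
      rw [hu]
      field_simp
    have hle : u ^ 2 ≤ c ^ 2 := by
      apply sq_le_sq'
      · nlinarith
      · nlinarith
    have hs := Real.sq_sqrt (sub_nonneg.2 hle)
    refine ⟨!₂[0, 0], !₂[a, 0], !₂[u, √(c ^ 2 - u ^ 2)], ?_, ?_, ?_⟩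
    · simp [EuclideanSpace.dist_eq, Real.dist_eq, Real.sqrt_sq_eq_abs, abs_of_nonneg ha]
    · rw [EuclideanSpace.dist_eq, Real.sqrt_eq_iff_mul_self_eq (by positivity) hb]
      simp only [Real.dist_eq, sq_abs, Fin.sum_univ_two]
      simp
      nlinarith
    · rw [EuclideanSpace.dist_eq, Real.sqrt_eq_iff_mul_self_eq (by positivity) hc]
      simp only [Real.dist_eq, sq_abs, Fin.sum_univ_two]
      simp
      nlinarith

theorem IsCAT0Space.hasStewartGeodesics {X : Type*} [MetricSpace X] (h : IsCAT0Space X) :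
    HasStewartGeodesics X := by
  intro x y
  obtain ⟨γ, hγ⟩ := h.1 x y
  refine ⟨γ, hγ, fun p t => ?_⟩
  obtain ⟨γ₁, hγ₁⟩ := h.1 y p
  obtain ⟨γ₂, hγ₂⟩ := h.1 p x
  let T : GeodesicTriangle X :=
    { vertex := ![x, y, p]
      side := ![γ, γ₁, γ₂]
      isGeodesic_side := by
        intro i
        fin_cases i
        exacts [hγ, hγ₁, hγ₂] }
  obtain ⟨w₀, w₁, w₂, h₀, h₁, h₂⟩ := exists_euclidean_triangle (a := dist x y) (b := dist y p)
    (c := dist p x) dist_nonneg dist_nonneg dist_nonneg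
    (by linarith [dist_triangle x p y, dist_comm x p, dist_comm y p])
    (by linarith [dist_triangle y x p, dist_comm x y, dist_comm x p])
    (by linarith [dist_triangle p y x, dist_comm x y, dist_comm y p])
  have hw : T.IsComparisonTriangle ![w₀, w₁, w₂] := by
    intro i
    fin_cases i
    exacts [h₀, h₁, h₂]
  have hle := h.2 T _ hw 2 0 p (γ t) w₂ (AffineMap.lineMap w₀ w₁ (t : ℝ))
    ⟨⟨0, hγ₂.1⟩, left_mem_segment ℝ w₂ w₀, by simp [T]⟩
    ⟨⟨t, rfl⟩, by
      change _ ∈ segment ℝ w₀ w₁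
      rw [segment_eq_image_lineMap]
      exact ⟨t, t.2, rfl⟩, by
      change dist w₀ _ = dist x (γ t)
      rw [hγ.dist_left, dist_left_lineMap, h₀, Real.norm_eq_abs, abs_of_nonneg t.2.1]⟩
  calc dist p (γ t) ^ 2 ≤ dist w₂ (AffineMap.lineMap w₀ w₁ (t : ℝ)) ^ 2 :=
        pow_le_pow_left₀ dist_nonneg hle 2
    _ = _ := by rw [dist_lineMap_sq, h₂, h₀, dist_comm w₂ w₁, h₁, dist_comm y p]

/-- Geodesics in a space with Stewart geodesics are unique, so that all of them satisfy the
inequality. -/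
theorem HasStewartGeodesics.dist_sq_le {X : Type*} [MetricSpace X] (h : HasStewartGeodesics X)
    {x y : X} {γ : unitInterval → X} (hγ : IsGeodesic γ x y) (p : X) (t : unitInterval) :
    dist p (γ t) ^ 2 ≤
      (1 - t) * dist p x ^ 2 + t * dist p y ^ 2 - t * (1 - t) * dist x y ^ 2 := by
  obtain ⟨γ', -, h'⟩ := h x y
  have h0 := h' (γ t) t
  rw [dist_comm (γ t) x, hγ.dist_left, hγ.dist_right] at h0
  have h1 : dist (γ t) (γ' t) ^ 2 ≤ 0 := by linarith
  have h2 : γ t = γ' t := by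
    rw [← dist_eq_zero]
    exact pow_eq_zero_iff two_ne_zero |>.1 (le_antisymm h1 (sq_nonneg _))
  rw [h2]
  exact h' p t

theorem HasStewartGeodesics.isGeodesicSpace {X : Type*} [MetricSpace X]
    (h : HasStewartGeodesics X) : IsGeodesicSpace X := fun x y =>
  let ⟨γ, hγ, _⟩ := h x y
  ⟨γ, hγ⟩

namespace GeodesicTriangle

variable {X : Type*} [MetricSpace X] {T : GeodesicTriangle X}
  {w : Fin 3 → EuclideanSpace ℝ (Fin 2)}

theorem IsComparisonPoint.exists_param (hw : T.IsComparisonTriangle w) {i : Fin 3} {x : X}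
    {x' : EuclideanSpace ℝ (Fin 2)} (h : T.IsComparisonPoint w i x x') :
    ∃ s : unitInterval, x = T.side i s ∧ x' = AffineMap.lineMap (w i) (w (i + 1)) (s : ℝ) := by
  obtain ⟨⟨s, rfl⟩, hseg, hd⟩ := h
  refine ⟨s, rfl, ?_⟩
  rw [segment_eq_image_lineMap] at hseg
  obtain ⟨r, hr, rfl⟩ := hseg
  rw [(T.isGeodesic_side i).dist_left, dist_left_lineMap, hw i, Real.norm_eq_abs,
    abs_of_nonneg hr.1] at hd
  by_cases h0 : dist (T.vertex i) (T.vertex (i + 1)) = 0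
  · have : w i = w (i + 1) := dist_eq_zero.1 ((hw i).trans h0)
    simp [this]
  · rw [mul_right_cancel₀ h0 hd]

/-- Comparison of points on two consecutive sides, by applying Stewart's inequality once along
each side. -/
theorem dist_side_le (hX : HasStewartGeodesics X) (hw : T.IsComparisonTriangle w) (i : Fin 3)
    (s t : unitInterval) :
    dist (T.side i s) (T.side (i + 1) t) ≤ dist (AffineMap.lineMap (w i) (w (i + 1)) (s : ℝ))
      (AffineMap.lineMap (w (i + 1)) (w (i + 1 + 1)) (t : ℝ)) := by
  have h1 := hX.dist_sq_le (T.isGeodesic_side (i + 1)) (T.side i s) t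
  have h2 := hX.dist_sq_le (T.isGeodesic_side i) (T.vertex (i + 1 + 1)) s
  have hi : i + 1 + 1 + 1 = i := by
    clear h1 h2
    decide +revert
  have e1 := hw i
  have e2 := hw (i + 1)
  have e3 := hw (i + 1 + 1)
  rw [hi] at e3
  refine (sq_le_sq₀ dist_nonneg dist_nonneg).1 ?_
  have h3 := (T.isGeodesic_side i).dist_right s
  have h4 : dist (AffineMap.lineMap (w i) (w (i + 1)) (s : ℝ)) (w (i + 1)) =
      (1 - s) * dist (T.vertex i) (T.vertex (i + 1)) := by
    rw [dist_lineMap_right, e1, Real.norm_eq_abs, abs_of_nonneg (sub_nonneg.2 s.2.2)]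
  rw [dist_lineMap_sq, dist_comm _ (w (i + 1 + 1)), dist_lineMap_sq, h4, e1, e2, e3,
    dist_comm (w (i + 1 + 1)) (w (i + 1)), e2]
  rw [dist_comm (T.vertex (i + 1 + 1)) (T.vertex (i + 1))] at h2
  rw [h3, dist_comm _ (T.vertex (i + 1 + 1))] at h1
  have h5 := mul_le_mul_of_nonneg_left h2 t.2.1
  linarith

end GeodesicTriangle

theorem isCAT0Space_iff_hasStewartGeodesics {X : Type*} [MetricSpace X] :
    IsCAT0Space X ↔ HasStewartGeodesics X := by
  refine ⟨fun h => h.hasStewartGeodesics, fun h => ⟨h.isGeodesicSpace, ?_⟩⟩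
  intro T w hw i j x y x' y' hx hy
  obtain ⟨s, rfl, rfl⟩ := hx.exists_param hw
  obtain ⟨t, rfl, rfl⟩ := hy.exists_param hw
  have hij : j = i ∨ j = i + 1 ∨ i = j + 1 := by
    clear hx hy
    decide +revert
  rcases hij with rfl | rfl | rfl
  · rw [(T.isGeodesic_side j).2.2, dist_lineMap_lineMap, hw j, Real.dist_eq]
  · exact GeodesicTriangle.dist_side_le h hw i s t
  · rw [dist_comm, dist_comm (AffineMap.lineMap _ _ _)]
    exact GeodesicTriangle.dist_side_le h hw j t s

theorem HasStewartGeodesics.of_isometryEquiv {X Y : Type*} [MetricSpace X] [MetricSpace Y]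
    (h : HasStewartGeodesics X) (e : X ≃ᵢ Y) : HasStewartGeodesics Y := by
  intro x y
  obtain ⟨γ, hγ, h'⟩ := h (e.symm x) (e.symm y)
  refine ⟨e ∘ γ, by simpa using hγ.comp_isometryEquiv e, fun p t => ?_⟩
  have := h' (e.symm p) t
  simp only [e.symm.dist_eq] at this
  rwa [← e.dist_eq, e.apply_symm_apply] at this

theorem hasStewartGeodesics_unitInterval : HasStewartGeodesics unitInterval := by
  intro x y
  have hmem : ∀ t : unitInterval, AffineMap.lineMap (x : ℝ) y (t : ℝ) ∈ unitInterval := fun t =>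
    (convex_Icc (0 : ℝ) 1).lineMap_mem x.2 y.2 t.2
  refine ⟨fun t => ⟨_, hmem t⟩, ⟨?_, ?_, fun s t => ?_⟩, fun p t => ?_⟩
  · simp
  · simp
  · rw [Subtype.dist_eq, dist_lineMap_lineMap, Subtype.dist_eq, Real.dist_eq (s : ℝ)]
  · simp only [Subtype.dist_eq]
    exact (dist_lineMap_sq _ _ _ _).le

/-! ### Wedges of scaled pointed metric spaces -/

/-- `Z` is the wedge at `o` of the pointed spaces `(Y i, b i)`, with the metric of `Y i` multiplied
by `c i`: the maps `f i : Y i → Z` are jointly surjective, multiply distances by `c i`, send the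
base points to `o`, and distances between points of different pieces are measured through `o`.
The factor `c i = 0` is allowed, and collapses the piece `Y i` to the point `o`. -/
structure IsScaledWedge {I : Type*} {Y : I → Type*} [∀ i, MetricSpace (Y i)] (b : ∀ i, Y i)
    (c : I → ℝ) {Z : Type*} [MetricSpace Z] (f : ∀ i, Y i → Z) (o : Z) : Prop where
  nonneg : ∀ i, 0 ≤ c i
  dist_same : ∀ i x y, dist (f i x) (f i y) = c i * dist x y
  map_base : ∀ i, f i (b i) = o
  dist_ne : ∀ i j x y, i ≠ j → dist (f i x) (f j y) = dist (f i x) o + dist o (f j y)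
  surj : ∀ z, ∃ i x, f i x = z

section Construction

variable {I : Type*} {Y : I → Type*} [∀ i, MetricSpace (Y i)]

open Classical in
/-- The distance of the wedge of scaled pointed spaces, on the disjoint union of the pieces; the
base points are at distance `0` from one another. -/
noncomputable def wedgeDist (b : ∀ i, Y i) (c : I → ℝ) (p q : Σ i, Y i) : ℝ :=
  if h : p.1 = q.1 then c q.1 * dist (h ▸ p.2) q.2
  else c p.1 * dist p.2 (b p.1) + c q.1 * dist q.2 (b q.1)

theorem wedgeDist_same (b : ∀ i, Y i) (c : I → ℝ) (i : I) (x y : Y i) :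
    wedgeDist b c ⟨i, x⟩ ⟨i, y⟩ = c i * dist x y := by
  simp [wedgeDist]

theorem wedgeDist_ne (b : ∀ i, Y i) (c : I → ℝ) {i j : I} (h : i ≠ j) (x : Y i) (y : Y j) :
    wedgeDist b c ⟨i, x⟩ ⟨j, y⟩ = c i * dist x (b i) + c j * dist y (b j) := by
  simp [wedgeDist, h]

theorem wedgeDist_base (b : ∀ i, Y i) (c : I → ℝ) (i j : I) (x : Y i) :
    wedgeDist b c ⟨i, x⟩ ⟨j, b j⟩ = c i * dist x (b i) := by
  by_cases h : i = j
  · subst h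
    exact wedgeDist_same b c i x (b i)
  · simp [wedgeDist_ne b c h]

/-- The pseudometric with distance `wedgeDist`. -/
@[reducible]
noncomputable def wedgePseudoMetric (b : ∀ i, Y i) (c : I → ℝ) (hc : ∀ i, 0 ≤ c i) :
    PseudoMetricSpace (Σ i, Y i) where
  dist := wedgeDist b c
  dist_self p := by
    change wedgeDist b c ⟨p.1, p.2⟩ ⟨p.1, p.2⟩ = 0
    rw [wedgeDist_same, dist_self, mul_zero]
  dist_comm := by
    rintro ⟨i, x⟩ ⟨j, y⟩
    by_cases h : i = j
    · subst h
      rw [wedgeDist_same, wedgeDist_same, dist_comm]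
    · rw [wedgeDist_ne b c h, wedgeDist_ne b c (Ne.symm h), add_comm]
  dist_triangle := by
    rintro ⟨i, x⟩ ⟨j, y⟩ ⟨k, z⟩
    have hpos : ∀ i (x y : Y i), 0 ≤ c i * dist x y := fun i x y =>
      mul_nonneg (hc i) dist_nonneg
    have htri : ∀ i (x y z : Y i), c i * dist x z ≤ c i * dist x y + c i * dist y z :=
      fun i x y z => by
        rw [← mul_add]
        exact mul_le_mul_of_nonneg_left (dist_triangle x y z) (hc i)
    by_cases hij : i = j
    · subst hij
      by_cases hik : i = k
      · subst hik
        simp only [wedgeDist_same]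
        exact htri i x y z
      · rw [wedgeDist_ne b c hik, wedgeDist_same, wedgeDist_ne b c hik]
        linarith [htri i x y (b i)]
    · by_cases hjk : j = k
      · subst hjk
        rw [wedgeDist_ne b c hij, wedgeDist_same, wedgeDist_ne b c hij]
        have := htri j z y (b j)
        rw [dist_comm z y] at this
        linarith
      · rw [wedgeDist_ne b c hij, wedgeDist_ne b c hjk]
        have := hpos j y (b j)
        by_cases hik : i = k
        · subst hik
          rw [wedgeDist_same]
          have h2 := htri i x (b i) z
          rw [dist_comm (b i) z] at h2
          linarith
        · rw [wedgeDist_ne b c hik]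
          linarith

end Construction

theorem exists_metric_quotient {α : Type} (m : PseudoMetricSpace α) :
    ∃ (Z : Type) (_ : MetricSpace Z) (π : α → Z), Function.Surjective π ∧
      ∀ p q, dist (π p) (π q) = m.dist p q :=
  ⟨SeparationQuotient α, inferInstance, SeparationQuotient.mk, SeparationQuotient.surjective_mk,
    fun p q => SeparationQuotient.dist_mk p q⟩

/-- Every family of pointed metric spaces has a wedge with prescribed scaling factors. -/
theorem exists_isScaledWedge {I : Type} [Nonempty I] {Y : I → Type} [∀ i, MetricSpace (Y i)]
    (b : ∀ i, Y i) (c : I → ℝ) (hc : ∀ i, 0 ≤ c i) :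
    ∃ (Z : Type) (_ : MetricSpace Z) (f : ∀ i, Y i → Z) (o : Z), IsScaledWedge b c f o := by
  obtain ⟨Z, _, π, hπ, hd⟩ := exists_metric_quotient (wedgePseudoMetric b c hc)
  replace hd : ∀ p q, dist (π p) (π q) = wedgeDist b c p q := hd
  let i₀ : I := Classical.arbitrary I
  refine ⟨Z, inferInstance, fun i x => π ⟨i, x⟩, π ⟨i₀, b i₀⟩, hc, ?_, ?_, ?_, ?_⟩
  · intro i x y
    rw [hd, wedgeDist_same]
  · intro i
    rw [← dist_eq_zero, hd, wedgeDist_base, dist_self, mul_zero]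
  · intro i j x y h
    rw [dist_comm (π ⟨i₀, b i₀⟩)]
    simp only [hd, wedgeDist_base, wedgeDist_ne b c h]
  · intro z
    obtain ⟨⟨i, x⟩, rfl⟩ := hπ z
    exact ⟨i, x, rfl⟩

/-- Stewart's inequality along a geodesic through `m`, at a point of the first part, when the point
of comparison is farther from `y` than from `m` by `dist m y`. Here `A = dist x m`, `B = dist m y`,
`P = dist p m`, `Q = dist p x`. -/
theorem stewart_concat_left {A B P Q s t d : ℝ} (hA : 0 ≤ A) (hB : 0 ≤ B)
    (hs : 0 ≤ s) (hst : s * A = t * (A + B))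
    (hQ : |P - A| ≤ Q) (hQ' : P ≤ Q + A) (hQA : Q ≤ P + A)
    (hd : d ^ 2 ≤ (1 - s) * Q ^ 2 + s * P ^ 2 - s * (1 - s) * A ^ 2) :
    d ^ 2 ≤ (1 - t) * Q ^ 2 + t * (P + B) ^ 2 - t * (1 - t) * (A + B) ^ 2 := by
  have hQ2 : (P - A) ^ 2 ≤ Q ^ 2 := sq_le_sq.2 (hQ.trans (le_abs_self Q))
  rcases hA.eq_or_lt with rfl | hA
  · have : P = Q := by linarith
    subst this
    have : t * B = 0 := by linarith
    have h2 : (1 - t) * P ^ 2 + t * (P + B) ^ 2 - t * (1 - t) * (0 + B) ^ 2 =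
        P ^ 2 + (t * B) * (2 * P + t * B) := by ring
    rw [h2, this]
    nlinarith
  · have hL : 0 < A + B := by linarith
    have key : (A + B) * ((1 - t) * Q ^ 2 + t * (P + B) ^ 2 - t * (1 - t) * (A + B) ^ 2 -
        ((1 - s) * Q ^ 2 + s * P ^ 2 - s * (1 - s) * A ^ 2)) = s * B * (Q ^ 2 - (P - A) ^ 2) := by
      have : t = s * A / (A + B) := by
        rw [hst]
        field_simp
      rw [this]
      field_simp
      ring
    have h3 : 0 ≤ s * B * (Q ^ 2 - (P - A) ^ 2) :=
      mul_nonneg (mul_nonneg hs hB) (sub_nonneg.2 hQ2)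
    rw [← key] at h3
    have := nonneg_of_mul_nonneg_right h3 hL
    linarith

/-- The companion of `stewart_concat_left` for a point of the second part. -/
theorem stewart_concat_right {A B P Q s t : ℝ} (ht : t ≤ 1)
    (hst : A + s * B = t * (A + B)) (hQ : |P - A| ≤ Q) :
    (P + s * B) ^ 2 ≤ (1 - t) * Q ^ 2 + t * (P + B) ^ 2 - t * (1 - t) * (A + B) ^ 2 := by
  have hQ2 : (P - A) ^ 2 ≤ Q ^ 2 := sq_le_sq.2 (hQ.trans (le_abs_self Q))
  have h1 : (P + s * B) ^ 2 =
      (1 - t) * (P - A) ^ 2 + t * (P + B) ^ 2 - t * (1 - t) * (A + B) ^ 2 := by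
    have : s * B = t * (A + B) - A := by linarith
    rw [this]
    ring
  rw [h1]
  have := mul_le_mul_of_nonneg_left hQ2 (sub_nonneg.2 ht)
  linarith

/-- Stewart's inequality persists when all distances from the point of comparison grow by the same
amount `P`. -/
theorem stewart_add {P a b z D t : ℝ} (hP : 0 ≤ P) (ha : 0 ≤ a) (hb : 0 ≤ b) (hz0 : 0 ≤ z)
    (ht : 0 ≤ t) (ht' : t ≤ 1) (hab : |a - b| ≤ D)
    (h : z ^ 2 ≤ (1 - t) * a ^ 2 + t * b ^ 2 - t * (1 - t) * D ^ 2) :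
    (P + z) ^ 2 ≤ (1 - t) * (P + a) ^ 2 + t * (P + b) ^ 2 - t * (1 - t) * D ^ 2 := by
  have hD : (a - b) ^ 2 ≤ D ^ 2 := sq_le_sq.2 (hab.trans (le_abs_self D))
  have h1t := sub_nonneg.2 ht'
  have hz : z ≤ (1 - t) * a + t * b := by
    refine (sq_le_sq₀ hz0 (by positivity)).1 ?_
    have := mul_le_mul_of_nonneg_left hD (mul_nonneg ht h1t)
    nlinarith
  have := mul_le_mul_of_nonneg_left hz hP
  nlinarith

namespace IsScaledWedge

variable {I : Type*} {Y : I → Type*} [∀ i, MetricSpace (Y i)] {b : ∀ i, Y i} {c : I → ℝ}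
  {Z : Type*} [MetricSpace Z] {f : ∀ i, Y i → Z} {o : Z}

theorem dist_map_base (h : IsScaledWedge b c f o) (i : I) (x : Y i) :
    dist (f i x) o = c i * dist x (b i) := by
  rw [← h.map_base i, h.dist_same]

theorem continuous_map (h : IsScaledWedge b c f o) (i : I) : Continuous (f i) :=
  (LipschitzWith.of_dist_le_mul (K := ⟨c i, h.nonneg i⟩) fun x y =>
    (h.dist_same i x y).le).continuous

theorem dist_le (h : IsScaledWedge b c f o) {η : ℝ} {i j : I} {x : Y i} {y : Y j}
    (hx : c i * dist x (b i) ≤ η) (hy : c j * dist y (b j) ≤ η) :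
    dist (f i x) (f j y) ≤ 2 * η := by
  have h1 := h.dist_map_base i x
  have h2 := h.dist_map_base j y
  have := dist_triangle_right (f i x) (f j y) o
  linarith

theorem compactSpace [∀ i, CompactSpace (Y i)] (h : IsScaledWedge b c f o)
    (hfin : ∀ η > 0, {i | ∃ x, η ≤ c i * dist x (b i)}.Finite) : CompactSpace Z := by
  rw [← isCompact_univ_iff, isCompact_iff_ultrafilter_le_nhds]
  intro U _
  by_cases hU : ∃ i, Set.range (f i) ∈ U
  · obtain ⟨i, hi⟩ := hU
    obtain ⟨z, -, hz⟩ := isCompact_iff_ultrafilter_le_nhds.1 (isCompact_range (h.continuous_map i))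
      U (Filter.le_principal_iff.2 hi)
    exact ⟨z, trivial, hz⟩
  · -- An ultrafilter that lives on no single piece converges to the common base point, because
    -- only finitely many pieces leave a given ball around it.
    refine ⟨o, trivial, ?_⟩
    rw [Metric.nhds_basis_ball.ge_iff]
    intro η hη
    by_contra hball
    have hcompl : (Metric.ball o η)ᶜ ∈ U := Ultrafilter.compl_mem_iff_notMem.2 hball
    have hsub : (Metric.ball o η)ᶜ ⊆ ⋃ i ∈ {i | ∃ x, η ≤ c i * dist x (b i)}, Set.range (f i) := by
      intro z hz
      obtain ⟨i, x, rfl⟩ := h.surj z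
      rw [Set.mem_compl_iff, Metric.mem_ball, not_lt, h.dist_map_base] at hz
      exact Set.mem_biUnion (⟨x, hz⟩ : i ∈ {i | ∃ x, η ≤ c i * dist x (b i)}) ⟨x, rfl⟩
    obtain ⟨i, -, hi⟩ :=
      (Ultrafilter.finite_biUnion_mem_iff (hfin η hη)).1 (Filter.mem_of_superset hcompl hsub)
    exact hU ⟨i, hi⟩

theorem connectedSpace (h : IsScaledWedge b c f o) (hY : ∀ i, ConnectedSpace (Y i)) :
    ConnectedSpace Z := by
  have huniv : (⋃ i, Set.range (f i)) = Set.univ := by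
    refine Set.eq_univ_of_forall fun z => ?_
    obtain ⟨i, x, rfl⟩ := h.surj z
    exact Set.mem_iUnion.2 ⟨i, x, rfl⟩
  have : IsPreconnected (⋃ i, Set.range (f i)) :=
    isPreconnected_iUnion ⟨o, Set.mem_iInter.2 fun i => ⟨b i, h.map_base i⟩⟩ fun i =>
      isPreconnected_range (h.continuous_map i)
  rw [huniv] at this
  exact { isPreconnected_univ := this, toNonempty := ⟨o⟩ }

theorem pathConnectedSpace (h : IsScaledWedge b c f o) (hY : ∀ i, PathConnectedSpace (Y i)) :
    PathConnectedSpace Z := by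
  have hj : ∀ z, Joined z o := by
    intro z
    obtain ⟨i, x, rfl⟩ := h.surj z
    rw [← h.map_base i]
    exact ⟨(PathConnectedSpace.somePath x (b i)).map (h.continuous_map i)⟩
  exact { nonempty := ⟨o⟩, joined := fun x y => (hj x).trans (hj y).symm }

theorem isGeodesic_map (h : IsScaledWedge b c f o) {i : I} {x y : Y i} {γ : unitInterval → Y i}
    (hγ : IsGeodesic γ x y) : IsGeodesic (f i ∘ γ) (f i x) (f i y) := by
  refine ⟨congrArg (f i) hγ.1, congrArg (f i) hγ.2.1, fun s t => ?_⟩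
  simp only [Function.comp_apply, h.dist_same, hγ.2.2 s t]
  ring

theorem isGeodesicSpace (h : IsScaledWedge b c f o) (hY : ∀ i, IsGeodesicSpace (Y i)) :
    IsGeodesicSpace Z := by
  intro z w
  obtain ⟨i, x, rfl⟩ := h.surj z
  obtain ⟨j, y, rfl⟩ := h.surj w
  by_cases hij : i = j
  · subst hij
    obtain ⟨γ, hγ⟩ := hY i x y
    exact ⟨_, h.isGeodesic_map hγ⟩
  · obtain ⟨γ₁, h₁⟩ := hY i x (b i)
    obtain ⟨γ₂, h₂⟩ := hY j (b j) y
    have h₁' := h.isGeodesic_map h₁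
    have h₂' := h.isGeodesic_map h₂
    rw [h.map_base] at h₁' h₂'
    obtain ⟨γ, hγ, -⟩ := h₁'.exists_concat h₂' (h.dist_ne i j x y hij).symm
    exact ⟨γ, hγ⟩

/-- A geodesic inside one piece satisfies Stewart's inequality with respect to all points of the
wedge. -/
theorem stewart_map (h : IsScaledWedge b c f o) {i : I} {x y : Y i} {γ : unitInterval → Y i}
    (hγ' : ∀ (p : Y i) (t : unitInterval), dist p (γ t) ^ 2 ≤
      (1 - t) * dist p x ^ 2 + t * dist p y ^ 2 - t * (1 - t) * dist x y ^ 2)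
    (z : Z) (t : unitInterval) :
    dist z (f i (γ t)) ^ 2 ≤ (1 - t) * dist z (f i x) ^ 2 + t * dist z (f i y) ^ 2 -
      t * (1 - t) * dist (f i x) (f i y) ^ 2 := by
  have hin : ∀ p : Y i, dist (f i p) (f i (γ t)) ^ 2 ≤ (1 - t) * dist (f i p) (f i x) ^ 2 +
      t * dist (f i p) (f i y) ^ 2 - t * (1 - t) * dist (f i x) (f i y) ^ 2 := by
    intro p
    simp only [h.dist_same]
    have := mul_le_mul_of_nonneg_left (hγ' p t) (sq_nonneg (c i))
    linarith
  obtain ⟨j, p, rfl⟩ := h.surj z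
  by_cases hij : j = i
  · subst hij
    exact hin p
  · have h0 := hin (b i)
    rw [h.map_base] at h0
    simp only [h.dist_ne j i p _ hij]
    exact stewart_add dist_nonneg dist_nonneg dist_nonneg dist_nonneg t.2.1 t.2.2
      (by simpa only [dist_comm o] using abs_dist_sub_le (f i x) (f i y) o) h0

theorem hasStewartGeodesics (h : IsScaledWedge b c f o) (hY : ∀ i, HasStewartGeodesics (Y i)) :
    HasStewartGeodesics Z := by
  intro z w
  obtain ⟨i, x, rfl⟩ := h.surj z
  obtain ⟨j, y, rfl⟩ := h.surj w
  by_cases hij : i = j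
  · subst hij
    obtain ⟨γ, hγ, hγ'⟩ := hY i x y
    exact ⟨_, h.isGeodesic_map hγ, h.stewart_map hγ'⟩
  · obtain ⟨γ₁, h₁, s₁⟩ := hY i x (b i)
    obtain ⟨γ₂, h₂, s₂⟩ := hY j (b j) y
    replace h₁ := h.isGeodesic_map h₁
    replace h₂ := h.isGeodesic_map h₂
    replace s₁ := h.stewart_map s₁
    replace s₂ := h.stewart_map s₂
    rw [h.map_base] at h₁ h₂ s₁ s₂
    have hxy := h.dist_ne i j x y hij
    obtain ⟨γ, hγ, hparam⟩ := h₁.exists_concat h₂ hxy.symm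
    refine ⟨γ, hγ, fun z t => ?_⟩
    -- The point `z` is outside at least one of the two pieces; by symmetry there are two similar
    -- cases, and in each the distances from `z` to the other piece are sums through `o`.
    obtain ⟨k, p, rfl⟩ := h.surj z
    by_cases hkj : k = j
    · have hki : k ≠ i := fun hk => hij (hk.symm.trans hkj)
      have hQ : |dist (f k p) o - dist o (f j y)| ≤ dist (f k p) (f j y) := by
        rw [dist_comm o]
        exact abs_dist_sub_le (f k p) (f j y) o
      replace hparam := hparam t
      rw [hxy] at hparam
      rw [hxy, h.dist_ne k i p x hki]
      rcases hparam with ⟨s, hs, hst⟩ | ⟨s, hs, hst⟩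
      · have := stewart_concat_right (A := dist o (f j y)) (B := dist (f i x) o)
          (s := 1 - s) (t := 1 - t) (by linarith [t.2.1]) (by linarith) hQ
        rw [hs, Function.comp_apply, h.dist_ne k i p _ hki, dist_comm o]
        have h5 := h₁.dist_right s
        rw [Function.comp_apply] at h5
        rw [h5, dist_comm o (f i x)]
        linarith
      · have := stewart_concat_left (A := dist o (f j y)) (B := dist (f i x) o)
          (s := 1 - s) (t := 1 - t) (d := dist (f k p) (f j (γ₂ s))) dist_nonneg dist_nonneg
          (by linarith [s.2.2]) (by linarith) hQ
          (by linarith [dist_triangle_right (f k p) o (f j y)])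
          (by linarith [dist_triangle (f k p) o (f j y)])
          (by linarith [s₂ (f k p) s])
        rw [hs, Function.comp_apply, dist_comm o (f i x)]
        linarith
    · have hQ : |dist (f k p) o - dist (f i x) o| ≤ dist (f k p) (f i x) :=
        abs_dist_sub_le (f k p) (f i x) o
      replace hparam := hparam t
      rw [hxy] at hparam
      rw [hxy, h.dist_ne k j p y hkj]
      rcases hparam with ⟨s, hs, hst⟩ | ⟨s, hs, hst⟩
      · rw [hs]
        exact stewart_concat_left dist_nonneg dist_nonneg s.2.1 hst hQ
          (by linarith [dist_triangle (f k p) (f i x) o])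
          (by linarith [dist_triangle_right (f k p) (f i x) o]) (s₁ (f k p) s)
      · rw [hs, Function.comp_apply, h.dist_ne k j p _ hkj]
        have h5 := h₂.dist_left s
        rw [Function.comp_apply] at h5
        rw [h5]
        exact stewart_concat_right t.2.2 hst hQ

/-- The distance functions of two wedges of the same pieces differ by little if the scaling factors
do, in proportion to the sizes of the pieces. -/
theorem abs_dist_sub_dist_le {c' : I → ℝ} {Z' : Type*} [MetricSpace Z'] {f' : ∀ i, Y i → Z'}
    {o' : Z'} (h : IsScaledWedge b c f o) (h' : IsScaledWedge b c' f' o') {η : ℝ}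
    (hη : ∀ i x, |c i - c' i| * dist x (b i) ≤ η) (i j : I) (x : Y i) (y : Y j) :
    |dist (f i x) (f j y) - dist (f' i x) (f' j y)| ≤ 2 * η := by
  have hx := hη i x
  have hy := hη j y
  by_cases hij : i = j
  · subst hij
    rw [h.dist_same, h'.dist_same, ← sub_mul, abs_mul, abs_of_nonneg (dist_nonneg (x := x))]
    have := mul_le_mul_of_nonneg_left (dist_triangle_right x y (b i)) (abs_nonneg (c i - c' i))
    linarith
  · rw [h.dist_ne i j x y hij, h'.dist_ne i j x y hij, dist_comm o, dist_comm o',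
      h.dist_map_base, h.dist_map_base, h'.dist_map_base, h'.dist_map_base]
    have e : c i * dist x (b i) + c j * dist y (b j) -
        (c' i * dist x (b i) + c' j * dist y (b j)) =
        (c i - c' i) * dist x (b i) + (c j - c' j) * dist y (b j) := by ring
    rw [e]
    refine (abs_add_le _ _).trans ?_
    rw [abs_mul, abs_mul, abs_of_nonneg (dist_nonneg (x := x)),
      abs_of_nonneg (dist_nonneg (x := y))]
    linarith

theorem ghDist_le {c' : I → ℝ} {Z' : Type*} [MetricSpace Z'] {f' : ∀ i, Y i → Z'} {o' : Z'}
    [CompactSpace Z] [Nonempty Z] [CompactSpace Z'] [Nonempty Z']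
    (h : IsScaledWedge b c f o) (h' : IsScaledWedge b c' f' o') {η : ℝ}
    (hη : ∀ i x, |c i - c' i| * dist x (b i) ≤ η) : ghDist Z Z' ≤ 3 * η := by
  choose u v huv using h.surj
  have key := h.abs_dist_sub_dist_le h' hη
  have := ghDist_le_of_approx_subsets (s := (Set.univ : Set Z))
    (fun z => f' (u z) (v z)) (ε₁ := 0) (ε₂ := 2 * η) (ε₃ := 2 * η) ?_ ?_ ?_
  · linarith
  · exact fun z => ⟨z, trivial, (dist_self z).le⟩
  · intro z'
    obtain ⟨i, x, rfl⟩ := h'.surj z'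
    refine ⟨⟨f i x, trivial⟩, ?_⟩
    have := key i (u (f i x)) x (v (f i x))
    rw [huv, dist_self, zero_sub, abs_neg, abs_of_nonneg dist_nonneg] at this
    exact this
  · intro z w
    have := key (u z) (u w) (v z) (v w)
    rwa [huv, huv] at this

/-- In a family of points of a wedge that are pairwise at distance at least `r`, at most one lies
outside the pieces in `J`, if the pieces outside `J` have radius less than `r / 2`. -/
theorem card_le_of_separated (h : IsScaledWedge b c f o) {r : ℝ} (J : Finset I) (N : I → ℕ)
    (hc : ∀ i ∈ J, c i ≤ 1)
    (hN : ∀ i ∈ J, ∀ (m : ℕ) (A : Finset (Fin m)) (g : Fin m → Y i),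
      (∀ a ∈ A, ∀ a' ∈ A, a ≠ a' → r ≤ dist (g a) (g a')) → A.card ≤ N i)
    (hJ : ∀ i ∉ J, ∀ x, 2 * (c i * dist x (b i)) < r)
    {m : ℕ} (g : Fin m → Z) (hg : ∀ a a', a ≠ a' → r ≤ dist (g a) (g a')) :
    m ≤ 1 + ∑ i ∈ J, N i := by
  classical
  choose u v huv using fun a => h.surj (g a)
  have hsplit : m = ((Finset.univ : Finset (Fin m)).filter (u · ∉ J)).card +
      ((Finset.univ : Finset (Fin m)).filter (u · ∈ J)).card := by
    rw [add_comm, Finset.card_filter_add_card_filter_not, Finset.card_univ, Fintype.card_fin]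
  rw [hsplit]
  refine add_le_add ?_ ?_
  · rw [Finset.card_le_one]
    intro a ha a' ha'
    by_contra hne
    simp only [Finset.mem_filter, Finset.mem_univ, true_and] at ha ha'
    have h1 := hJ _ ha (v a)
    have h2 := hJ _ ha' (v a')
    have h3 := hg a a' hne
    rw [← huv a, ← huv a'] at h3
    have h4 := dist_triangle_right (f (u a) (v a)) (f (u a') (v a')) o
    rw [h.dist_map_base, h.dist_map_base] at h4
    linarith
  · rw [Finset.card_eq_sum_card_fiberwise (f := u) (t := J) (fun a ha => by simpa using ha)]
    refine Finset.sum_le_sum fun i hi => ?_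
    have hv : ∀ a, ∃ y : Y i, u a = i → f i y = g a := by
      intro a
      by_cases hai : u a = i
      · subst hai
        exact ⟨v a, fun _ => huv a⟩
      · exact ⟨b i, fun h => absurd h hai⟩
    choose w hw using hv
    refine hN i hi m _ w fun a ha a' ha' hne => ?_
    simp only [Finset.mem_filter, Finset.mem_univ, true_and] at ha ha'
    have h1 := hg a a' hne
    rw [← hw a ha.2, ← hw a' ha'.2, h.dist_same] at h1
    exact h1.trans (mul_le_of_le_one_left dist_nonneg (hc i hi))

end IsScaledWedge

/-- Finiteness of the packing numbers of a compact space. -/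
theorem exists_card_le_of_separated (Y : Type*) [MetricSpace Y] [CompactSpace Y] {r : ℝ}
    (hr : 0 < r) : ∃ N : ℕ, ∀ (m : ℕ) (A : Finset (Fin m)) (g : Fin m → Y),
      (∀ a ∈ A, ∀ a' ∈ A, a ≠ a' → r ≤ dist (g a) (g a')) → A.card ≤ N := by
  obtain ⟨t, -, htfin, ht⟩ := finite_cover_balls_of_compact (isCompact_univ (X := Y)) (half_pos hr)
  refine ⟨htfin.toFinset.card, fun m A g hg => ?_⟩
  have hcov : ∀ a, ∃ y ∈ t, dist (g a) y < r / 2 := by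
    intro a
    simpa using ht (Set.mem_univ (g a))
  choose φ hφt hφ using hcov
  refine Finset.card_le_card_of_injOn φ (fun a _ => by simpa using hφt a) ?_
  intro a ha a' ha' heq
  by_contra hne
  have h1 := hg a ha a' ha' hne
  have h2 := hφ a
  have h3 := hφ a'
  rw [← heq] at h3
  have := dist_triangle_right (g a) (g a') (φ a)
  linarith

/-! ### Wedges as points of the Gromov–Hausdorff space -/

theorem nonempty_isometryEquiv_rep (X : Type*) [MetricSpace X] [CompactSpace X] [Nonempty X] :
    Nonempty (X ≃ᵢ (toGHSpace X).Rep) :=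
  toGHSpace_eq_toGHSpace_iff_isometryEquiv.1 (GHSpace.toGHSpace_rep _).symm

theorem IsScaledWedge.comp_isometryEquiv {I : Type*} {Y : I → Type*} [∀ i, MetricSpace (Y i)]
    {b : ∀ i, Y i} {c : I → ℝ} {Z Z' : Type*} [MetricSpace Z] [MetricSpace Z']
    {f : ∀ i, Y i → Z} {o : Z} (h : IsScaledWedge b c f o) (e : Z ≃ᵢ Z') :
    IsScaledWedge b c (fun i => e ∘ f i) (e o) where
  nonneg := h.nonneg
  dist_same i x y := by simp only [Function.comp_apply, e.dist_eq, h.dist_same]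
  map_base i := congrArg e (h.map_base i)
  dist_ne i j x y hij := by simp only [Function.comp_apply, e.dist_eq, h.dist_ne i j x y hij]
  surj z := by
    obtain ⟨i, x, hx⟩ := h.surj (e.symm z)
    exact ⟨i, x, by simp [hx]⟩

theorem exists_isScaledWedge_rep {I : Type} [Nonempty I] {Y : I → Type} [∀ i, MetricSpace (Y i)]
    [∀ i, CompactSpace (Y i)] (b : ∀ i, Y i) (c : I → ℝ) (hc : ∀ i, 0 ≤ c i)
    (hfin : ∀ η > 0, {i | ∃ x, η ≤ c i * dist x (b i)}.Finite) :
    ∃ (q : GHSpace) (f : ∀ i, Y i → q.Rep) (o : q.Rep), IsScaledWedge b c f o := by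
  obtain ⟨Z, _, f, o, h⟩ := exists_isScaledWedge b c hc
  have := h.compactSpace hfin
  have : Nonempty Z := ⟨o⟩
  obtain ⟨e⟩ := nonempty_isometryEquiv_rep Z
  exact ⟨toGHSpace Z, _, _, h.comp_isometryEquiv e⟩

/-- If all pieces but one are collapsed and that one is not rescaled, then the wedge is isometric
to it. -/
theorem IsScaledWedge.eq_piece {I : Type*} {p : I → GHSpace} {b : ∀ i, (p i).Rep} {c : I → ℝ}
    {q : GHSpace} {f : ∀ i, (p i).Rep → q.Rep} {o : q.Rep} (h : IsScaledWedge b c f o) {i : I}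
    (hi : c i = 1) (h0 : ∀ j, j ≠ i → c j = 0) : q = p i := by
  have hiso : Isometry (f i) := Isometry.of_dist_eq fun x y => by rw [h.dist_same, hi, one_mul]
  have hsurj : Function.Surjective (f i) := by
    intro z
    obtain ⟨j, x, rfl⟩ := h.surj z
    by_cases hj : j = i
    · subst hj
      exact ⟨x, rfl⟩
    · refine ⟨b i, ?_⟩
      rw [h.map_base, eq_comm, ← dist_eq_zero, h.dist_map_base, h0 j hj, zero_mul]
  have e : (p i).Rep ≃ᵢ q.Rep :=
    { Equiv.ofBijective (f i) ⟨hiso.injective, hsurj⟩ with isometry_toFun := hiso }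
  rw [← q.toGHSpace_rep, ← (p i).toGHSpace_rep]
  exact toGHSpace_eq_toGHSpace_iff_isometryEquiv.2 ⟨e.symm⟩

theorem IsScaledWedge.mem_of_forall_mem {I : Type*} {p : I → GHSpace} {b : ∀ i, (p i).Rep}
    {c : I → ℝ} {q : GHSpace} {f : ∀ i, (p i).Rep → q.Rep} {o : q.Rep}
    (h : IsScaledWedge b c f o) {S : Set GHSpace}
    (hS : S = connectedSpaces ∨ S = pathConnectedSpaces ∨ S = geodesicSpaces ∨ S = cat0Spaces)
    (hp : ∀ i, p i ∈ S) : q ∈ S := by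
  rcases hS with rfl | rfl | rfl | rfl
  · exact h.connectedSpace hp
  · exact h.pathConnectedSpace hp
  · exact h.isGeodesicSpace hp
  · exact isCAT0Space_iff_hasStewartGeodesics.2
      (h.hasStewartGeodesics fun i => isCAT0Space_iff_hasStewartGeodesics.1 (hp i))

theorem toGHSpace_unitInterval_mem {S : Set GHSpace}
    (hS : S = connectedSpaces ∨ S = pathConnectedSpaces ∨ S = geodesicSpaces ∨ S = cat0Spaces) :
    toGHSpace unitInterval ∈ S := by
  obtain ⟨e⟩ := nonempty_isometryEquiv_rep unitInterval
  have hst := hasStewartGeodesics_unitInterval.of_isometryEquiv e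
  rcases hS with rfl | rfl | rfl | rfl
  · exact e.toHomeomorph.surjective.connectedSpace e.continuous
  · have : PathConnectedSpace unitInterval := isPathConnected_iff_pathConnectedSpace.1
      ((convex_Icc (0 : ℝ) 1).isPathConnected ⟨0, unitInterval.zero_mem⟩)
    exact e.toHomeomorph.surjective.pathConnectedSpace e.continuous
  · exact hst.isGeodesicSpace
  · exact isCAT0Space_iff_hasStewartGeodesics.2 hst

/-! ### Lengths of the intervals -/

theorem exists_frequently_mem_open (H : Type*) [TopologicalSpace H] [SeparableSpace H]
    [Nonempty H] : ∃ u : ℕ → H, ∀ U : Set H, IsOpen U → U.Nonempty →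
      ∃ᶠ k in Filter.atTop, u k ∈ U := by
  refine ⟨fun k => denseSeq H k.unpair.1, fun U hU hne => ?_⟩
  obtain ⟨j, hj⟩ := (denseRange_denseSeq H).exists_mem_open hU hne
  rw [Filter.frequently_atTop]
  intro N
  exact ⟨Nat.pair j N, Nat.right_le_pair j N, by simpa using hj⟩

/-- Functions `w k` that vanish on the finite set `range v`, decay like `4⁻ᵏ`, and
determine the points outside `range v`; for this it is enough to compare those values of `w k`
that are not smaller than `8⁻ᵏ`. -/
theorem exists_interval_lengths {H : Type*} [MetricSpace H] [CompactSpace H] {n : ℕ}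
    (v : Fin (n + 1) → H) :
    ∃ w : ℕ → H → ℝ, (∀ k h, 0 ≤ w k h) ∧ (∀ k h, w k h ≤ (1 / 4) ^ k) ∧
      (∀ j k h, j ≤ k → w k h ≤ w j h) ∧ (∀ k h h', |w k h - w k h'| ≤ 3 * dist h h') ∧
      (∀ k i, w k (v i) = 0) ∧
      ∀ h h', h ∉ Set.range v → (∀ k, (1 / 8) ^ k ≤ 2 * w k h → w k h ≤ w k h') →
        (∀ k, (1 / 8) ^ k ≤ 2 * w k h' → w k h' ≤ w k h) → h = h' := by
  have : Nonempty H := ⟨v 0⟩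
  obtain ⟨u, hu⟩ := exists_frequently_mem_open H
  -- `w k h` is `ε h * 4⁻ᵏ⁻¹ * (1 + min 1 (dist h (u k)))`: the factor `ε` vanishes exactly on
  -- `range v`, and the last one is between `1` and `2`, which keeps `w k h` decreasing in `k`.
  set ε : H → ℝ := fun h => min 1 (Metric.infDist h (Set.range v)) with hε
  have hε0 : ∀ h, 0 ≤ ε h := fun h => le_min zero_le_one Metric.infDist_nonneg
  have hε1 : ∀ h, ε h ≤ 1 := fun h => min_le_left _ _
  have hεpos : ∀ h, h ∉ Set.range v ↔ 0 < ε h := by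
    intro h
    rw [hε, lt_min_iff, (Set.finite_range v).isClosed.mem_iff_infDist_zero (Set.range_nonempty v)]
    constructor
    · exact fun h1 => ⟨one_pos, lt_of_le_of_ne Metric.infDist_nonneg (Ne.symm h1)⟩
    · exact fun h1 => h1.2.ne'
  have hεlip : ∀ h h', |ε h - ε h'| ≤ dist h h' := by
    intro h h'
    refine (abs_min_sub_min_le_max _ _ _ _).trans ?_
    rw [sub_self, abs_zero]
    refine max_le dist_nonneg ?_
    rw [← Real.dist_eq]
    simpa using (Metric.lipschitz_infDist_pt (Set.range v)).dist_le_mul h h'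
  set g : H → H → ℝ := fun y h => 1 + min 1 (dist h y) with hg
  have hg1 : ∀ y h, 1 ≤ g y h := fun y h => by
    have : 0 ≤ min 1 (dist h y) := le_min zero_le_one dist_nonneg
    simp only [hg]
    linarith
  have hg2 : ∀ y h, g y h ≤ 2 := fun y h => by
    have : min 1 (dist h y) ≤ 1 := min_le_left _ _
    simp only [hg]
    linarith
  have hglip : ∀ y h h', |g y h - g y h'| ≤ dist h h' := by
    intro y h h'
    rw [hg, add_sub_add_left_eq_sub]
    refine (abs_min_sub_min_le_max _ _ _ _).trans ?_
    rw [sub_self, abs_zero]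
    exact max_le dist_nonneg (abs_dist_sub_le h h' y)
  have hpow : ∀ k : ℕ, (0 : ℝ) < (1 / 4) ^ (k + 1) := fun k => by positivity
  have hpow1 : ∀ k : ℕ, ((1 : ℝ) / 4) ^ (k + 1) ≤ 1 := fun k =>
    pow_le_one₀ (by norm_num) (by norm_num)
  have hge : ∀ k h, ε h * (1 / 4) ^ (k + 1) ≤ ε h * ((1 / 4) ^ (k + 1) * g (u k) h) := fun k h =>
    mul_le_mul_of_nonneg_left (le_mul_of_one_le_right (hpow k).le (hg1 _ _)) (hε0 h)
  have hle : ∀ k h, ε h * ((1 / 4) ^ (k + 1) * g (u k) h) ≤ ε h * ((1 / 4) ^ (k + 1) * 2) :=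
    fun k h => mul_le_mul_of_nonneg_left (mul_le_mul_of_nonneg_left (hg2 _ _) (hpow k).le) (hε0 h)
  -- One of the two comparisons already gives an inequality between continuous functions of `y`,
  -- because the sequence `u` returns to every open set infinitely often.
  have hcomp : ∀ h h', h ∉ Set.range v →
      (∀ k, (1 / 8) ^ k ≤ 2 * (ε h * ((1 / 4) ^ (k + 1) * g (u k) h)) →
        ε h * ((1 / 4) ^ (k + 1) * g (u k) h) ≤ ε h' * ((1 / 4) ^ (k + 1) * g (u k) h')) →
      ∀ y, ε h * g y h ≤ ε h' * g y h' := by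
    intro h h' hh hk
    have hpos := (hεpos h).1 hh
    have hev : ∀ᶠ k in Filter.atTop, ε h * g (u k) h ≤ ε h' * g (u k) h' := by
      have ht := tendsto_pow_atTop_nhds_zero_of_lt_one (r := (1 : ℝ) / 2) (by norm_num) (by norm_num)
      filter_upwards [ht.eventually_lt_const (half_pos hpos)] with k hk2
      have h8 : ((1 : ℝ) / 8) ^ k = (1 / 4) ^ k * (1 / 2) ^ k := by
        rw [← mul_pow]
        norm_num
      have h1 : ((1 : ℝ) / 8) ^ k ≤ 2 * (ε h * (1 / 4) ^ (k + 1)) := by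
        rw [h8, pow_succ]
        have := mul_le_mul_of_nonneg_left hk2.le (pow_nonneg (by norm_num : (0 : ℝ) ≤ 1 / 4) k)
        linarith
      have h2 := hk k (h1.trans (by linarith [hge k h]))
      refine le_of_mul_le_mul_left ?_ (hpow k)
      linarith
    intro y
    by_contra! hy
    have hopen : IsOpen {y | ε h' * g y h' < ε h * g y h} :=
      isOpen_lt (by fun_prop) (by fun_prop)
    obtain ⟨k, h1, h2⟩ := ((hu _ hopen ⟨y, hy⟩).and_eventually hev).exists
    exact absurd h2 (not_le.2 h1)
  refine ⟨fun k h => ε h * ((1 / 4) ^ (k + 1) * g (u k) h), fun k h => ?_, fun k h => ?_,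
    fun j k h hjk => ?_, fun k h h' => ?_, fun k i => ?_, fun h h' hh h₁ h₂ => ?_⟩
  · exact (mul_nonneg (hε0 h) (hpow k).le).trans (hge k h)
  · have h1 := mul_le_mul_of_nonneg_right (hε1 h) (hpow k).le
    have h2 := hle k h
    have h3 := hpow k
    rw [pow_succ] at h1 h2 h3
    change ε h * ((1 / 4) ^ (k + 1) * g (u k) h) ≤ _
    rw [pow_succ]
    linarith
  · rcases hjk.eq_or_lt with rfl | hlt
    · exact le_rfl
    · refine (hle k h).trans (le_trans ?_ (hge j h))
      refine mul_le_mul_of_nonneg_left ?_ (hε0 h)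
      have : ((1 : ℝ) / 4) ^ (k + 1) ≤ (1 / 4) ^ (j + 1 + 1) :=
        pow_le_pow_of_le_one (by norm_num) (by norm_num) (by omega)
      rw [pow_succ _ (j + 1)] at this
      linarith [hpow j]
  · have e : ε h * ((1 / 4) ^ (k + 1) * g (u k) h) - ε h' * ((1 / 4) ^ (k + 1) * g (u k) h') =
        (1 / 4) ^ (k + 1) * ((ε h - ε h') * g (u k) h + ε h' * (g (u k) h - g (u k) h')) := by
      ring
    have h1 : |(ε h - ε h') * g (u k) h| ≤ dist h h' * 2 := by
      rw [abs_mul, abs_of_nonneg (zero_le_one.trans (hg1 (u k) h))]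
      exact mul_le_mul (hεlip h h') (hg2 _ _) (zero_le_one.trans (hg1 (u k) h)) dist_nonneg
    have h2 : |ε h' * (g (u k) h - g (u k) h')| ≤ 1 * dist h h' := by
      rw [abs_mul, abs_of_nonneg (hε0 h')]
      exact mul_le_mul (hε1 h') (hglip _ _ _) (abs_nonneg _) zero_le_one
    rw [e, abs_mul, abs_of_pos (hpow k)]
    refine (mul_le_of_le_one_left (abs_nonneg _) (hpow1 k)).trans ?_
    linarith [abs_add_le ((ε h - ε h') * g (u k) h) (ε h' * (g (u k) h - g (u k) h'))]
  · have : ε (v i) = 0 := by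
      refine le_antisymm (not_lt.1 fun h => (hεpos _).2 h ⟨i, rfl⟩) (hε0 _)
    simp only [this, zero_mul]
  · -- The comparison at `y = h'` and its mirror image at `y = h` give
    -- `ε h * (1 + δ) ≤ ε h'` and `ε h' * (1 + δ) ≤ ε h` with `δ = min 1 (dist h h')`, so `δ = 0`.
    have h3 := hcomp h h' hh h₁ h'
    have hpos := (hεpos h).1 hh
    have hself : ∀ y, g y y = 1 := fun y => by simp [hg]
    rw [hself, mul_one] at h3
    have hh' : h' ∉ Set.range v := by
      rw [hεpos]
      exact (mul_pos hpos (zero_lt_one.trans_le (hg1 h' h))).trans_le h3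
    have h4 := hcomp h' h hh' h₂ h
    rw [hself, mul_one] at h4
    have hpos' := (hεpos h').1 hh'
    simp only [hg, dist_comm h' h] at h3 h4
    have h5 : min 1 (dist h h') ≤ 0 := by
      by_contra! hlt
      nlinarith [mul_pos hpos hlt, mul_pos hpos' hlt]
    rcases min_le_iff.1 h5 with h6 | h6
    · linarith
    · exact dist_le_zero.1 h6

theorem exists_rapidly_growing (A B : ℕ → ℕ) :
    ∃ m : ℕ → ℕ, ∀ k, A k + B k * ∑ j ∈ Finset.range k, m j < m k := by
  let s : ℕ → ℕ := fun k => Nat.rec 0 (fun k s => s + (A k + B k * s + 1)) k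
  refine ⟨fun k => A k + B k * s k + 1, fun k => ?_⟩
  have : ∀ k, ∑ j ∈ Finset.range k, (A j + B j * s j + 1) = s k := by
    intro k
    induction k with
    | zero => rfl
    | succ k ih => rw [Finset.sum_range_succ, ih]
  rw [this]
  exact Nat.lt_succ_self _

end Continua

/-! ### The embedding -/

open Continua in
theorem theorem1p1 (n : ℕ) (hn : 1 ≤ n)
    {H : Type*} [TopologicalSpace H] [CompactSpace H] [MetrizableSpace H]
    (v : Fin (n + 1) → H) (hv : ∀ i j, i ≠ j → v i ≠ v j)
    (S : Set GHSpace)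
    (hS : S = Continua.connectedSpaces ∨ S = Continua.pathConnectedSpaces ∨
      S = Continua.geodesicSpaces ∨ S = Continua.cat0Spaces)
    (X : Fin (n + 1) → S)
    (hX : ∀ i j, i ≠ j → 0 < dist (X i : GHSpace) (X j : GHSpace)) :
    ∃ Φ : H → S, IsEmbedding Φ ∧ ∀ i, Φ (v i) = X i := by
  let : MetricSpace H := metrizableSpaceMetric H
  obtain ⟨w, hw0, hw1, hwanti, hwlip, hwv, hwinj⟩ := exists_interval_lengths v
  have hbump : ∀ i, ∃ l : C(H, ℝ), l (v i) = 1 ∧ (∀ j, j ≠ i → l (v j) = 0) ∧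
      ∀ h, l h ∈ Set.Icc (0 : ℝ) 1 := by
    intro i
    obtain ⟨l, h0, h1, h01⟩ := exists_continuous_zero_one_of_isClosed
      (s := v '' {j | j ≠ i}) (t := {v i}) (Set.toFinite _).isClosed isClosed_singleton
      (Set.disjoint_singleton_right.2 fun ⟨j, hj, hji⟩ => hv j i hj hji)
    exact ⟨l, h1 rfl, fun j hj => h0 ⟨j, hj, rfl⟩, h01⟩
  choose l hl1 hl0 hl01 using hbump
  obtain ⟨e⟩ := nonempty_isometryEquiv_rep unitInterval
  set L : GHSpace := toGHSpace unitInterval with hL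
  have hLle : ∀ x : L.Rep, dist x (e 0) ≤ 1 := by
    intro x
    obtain ⟨t, rfl⟩ := e.surjective x
    rw [e.dist_eq, Subtype.dist_eq, Real.dist_eq, Set.Icc.coe_zero, sub_zero,
      abs_of_nonneg t.2.1]
    exact t.2.2
  have hLtip : dist (e 1) (e 0) = 1 := by
    rw [e.dist_eq, Subtype.dist_eq, Real.dist_eq]
    simp
  have h8 : ∀ k : ℕ, (0 : ℝ) < (1 / 8) ^ k := fun k => by positivity
  choose NX hNX using fun (i : Fin (n + 1)) (k : ℕ) =>
    exists_card_le_of_separated (X i : GHSpace).Rep (h8 k)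
  choose NL hNL using fun k : ℕ => exists_card_le_of_separated L.Rep (h8 k)
  obtain ⟨m, hm⟩ := exists_rapidly_growing (fun k => 1 + ∑ i, NX i k) NL
  let p : Fin (n + 1) ⊕ (Σ k, Fin (m k)) → GHSpace := Sum.elim (fun i => X i) fun _ => L
  let b : ∀ i, (p i).Rep := Sum.rec (fun i => Classical.arbitrary (X i : GHSpace).Rep) fun _ => e 0
  let c : H → Fin (n + 1) ⊕ (Σ k, Fin (m k)) → ℝ := fun h =>
    Sum.elim (fun i => l i h) fun t => w t.1 h
  -- the pieces `X i`, and the intervals of the levels before `k`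
  let J : ℕ → Finset (Fin (n + 1) ⊕ (Σ k, Fin (m k))) := fun k =>
    Finset.univ.disjSum ((Finset.range k).sigma fun _ => Finset.univ)
  have hc0 : ∀ h i, 0 ≤ c h i := by
    rintro h (i | t)
    exacts [(hl01 i h).1, hw0 t.1 h]
  have hc1 : ∀ h i, c h i ≤ 1 := by
    rintro h (i | t)
    exacts [(hl01 i h).2, (hw1 t.1 h).trans (pow_le_one₀ (by norm_num) (by norm_num))]
  have hfin : ∀ h, ∀ η > 0, {i | ∃ x, η ≤ c h i * dist x (b i)}.Finite := by
    intro h η hη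
    obtain ⟨k, hk⟩ := exists_pow_lt_of_lt_one hη (by norm_num : (1 : ℝ) / 4 < 1)
    refine (J k).finite_toSet.subset ?_
    rintro (i | t) ⟨x, hx⟩
    · simp [J]
    · have h1 : η ≤ w t.1 h := hx.trans (mul_le_of_le_one_right (hw0 _ _) (hLle x))
      have h2 : t.1 < k := by
        by_contra! hkt
        linarith [hw1 k h, hwanti k t.1 h hkt]
      simpa [J] using h2
  choose q f o hq using fun h => exists_isScaledWedge_rep b (c h) (hc0 h) (hfin h)
  have hqS : ∀ h, q h ∈ S := fun h => (hq h).mem_of_forall_mem hS (by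
    rintro (i | t)
    exacts [(X i).2, toGHSpace_unitInterval_mem hS])
  have hqv : ∀ i, q (v i) = X i := by
    intro i
    refine (hq (v i)).eq_piece (i := Sum.inl i) (hl1 i) ?_
    rintro (j | t) hj
    · exact hl0 j i fun h => hj (by rw [h])
    · exact hwv t.1 i
  -- The free endpoints of the intervals of level `k` are `m k` points at mutual distance
  -- `2 * w k h`, and by `hnsep` mutual distances cannot be larger, as long as they are not below
  -- the resolution `8⁻ᵏ` at which `m k` exceeds the packing numbers of the larger pieces.
  have hsep : ∀ h k, ∃ g : Fin (m k) → (q h).Rep,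
      ∀ a a', a ≠ a' → 2 * w k h ≤ dist (g a) (g a') := by
    intro h k
    let tip : ∀ a : Fin (m k), (p (Sum.inr ⟨k, a⟩)).Rep := fun _ => e 1
    refine ⟨fun a => f h (Sum.inr ⟨k, a⟩) (tip a), fun a a' haa' => ?_⟩
    have hne : (Sum.inr ⟨k, a⟩ : Fin (n + 1) ⊕ (Σ k, Fin (m k))) ≠ Sum.inr ⟨k, a'⟩ := by
      simpa using haa'
    have hd : ∀ a, dist (f h (Sum.inr ⟨k, a⟩) (tip a)) (o h) = w k h := fun a =>
      ((hq h).dist_map_base (Sum.inr ⟨k, a⟩) (tip a)).trans (by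
        change w k h * dist (e 1) (e 0) = w k h
        rw [hLtip, mul_one])
    have h1 := (hq h).dist_ne _ _ (tip a) (tip a') hne
    rw [dist_comm (o h), hd, hd] at h1
    exact (two_mul (w k h)).trans_le h1.ge
  have hnsep : ∀ h k r, 2 * w k h < r → (1 / 8) ^ k ≤ r → ∀ g : Fin (m k) → (q h).Rep,
      ¬ ∀ a a', a ≠ a' → r ≤ dist (g a) (g a') := by
    intro h k r hr hr8 g hg
    have := (hq h).card_le_of_separated (J k) (Sum.elim (fun i => NX i k) fun _ => NL k)
      (fun i _ => hc1 h i) ?_ ?_ g hg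
    · simp only [J, Finset.sum_disjSum, Sum.elim_inl, Sum.elim_inr, Finset.sum_const,
        Finset.card_sigma, Finset.card_univ, Fintype.card_fin, smul_eq_mul] at this
      have h2 := hm k
      rw [mul_comm] at h2
      omega
    · rintro (i | t) - m' A g' hA
      · exact hNX i k m' A g' fun a ha a' ha' hne => hr8.trans (hA a ha a' ha' hne)
      · exact hNL k m' A g' fun a ha a' ha' hne => hr8.trans (hA a ha a' ha' hne)
    · rintro (i | t) hi x
      · simp [J] at hi
      · have hkt : k ≤ t.1 := by simpa [J] using hi
        have h1 : w t.1 h * dist x (e 0) ≤ w t.1 h := mul_le_of_le_one_right (hw0 _ _) (hLle x)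
        have h2 := hwanti k t.1 h hkt
        change 2 * (w t.1 h * dist x (e 0)) < r
        linarith
  have hcompare : ∀ h h', q h = q h' → ∀ k, (1 / 8) ^ k ≤ 2 * w k h → w k h ≤ w k h' := by
    intro h h' heq k hk
    by_contra! hlt
    obtain ⟨g, hg⟩ : ∃ g : Fin (m k) → (q h').Rep, ∀ a a', a ≠ a' →
        2 * w k h ≤ dist (g a) (g a') := heq ▸ hsep h k
    exact hnsep h' k _ (by linarith) hk g hg
  have hinj : Function.Injective q := by
    intro h h' heq
    have h1 := hcompare h h' heq
    have h2 := hcompare h' h heq.symm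
    by_cases hh : h ∈ Set.range v
    · by_cases hh' : h' ∈ Set.range v
      · obtain ⟨i, rfl⟩ := hh
        obtain ⟨j, rfl⟩ := hh'
        rw [hqv, hqv] at heq
        by_contra hne
        have := hX i j fun hij => hne (by rw [hij])
        rw [heq, dist_self] at this
        exact lt_irrefl _ this
      · exact (hwinj h' h hh' h2 h1).symm
    · exact hwinj h h' hh h1 h2
  have hcont : Continuous q := by
    rw [continuous_iff_continuousAt]
    intro h
    rw [ContinuousAt, Metric.tendsto_nhds]
    intro η hη
    have hη4 : 0 < η / 4 := by linarith
    have hev : ∀ i, ∀ᶠ h' in 𝓝 h, ∀ x : (X i : GHSpace).Rep,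
        |l i h' - l i h| * dist x (b (Sum.inl i)) ≤ η / 4 := by
      intro i
      have ht : Filter.Tendsto (fun h' => |l i h' - l i h| *
          Metric.diam (Set.univ : Set (X i : GHSpace).Rep)) (𝓝 h) (𝓝 0) := by
        have : Continuous fun h' => |l i h' - l i h| *
          Metric.diam (Set.univ : Set (X i : GHSpace).Rep) := by fun_prop
        simpa using this.tendsto h
      filter_upwards [ht.eventually_lt_const hη4] with h' hh' x
      refine le_trans (mul_le_mul_of_nonneg_left ?_ (abs_nonneg _)) hh'.le
      exact Metric.dist_le_diam_of_mem isCompact_univ.isBounded trivial trivial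
    have hball : ∀ᶠ h' in 𝓝 h, 3 * dist h' h < η / 4 := by
      have : Continuous fun h' => 3 * dist h' h := by fun_prop
      exact (this.tendsto h).eventually_lt_const (by simpa using hη4)
    filter_upwards [Filter.eventually_all.2 hev, hball] with h' h1 h2
    rw [dist_ghDist]
    have := (hq h').ghDist_le (hq h) (η := η / 4) (by
      rintro (i | t) x
      · exact h1 i x
      · refine (mul_le_of_le_one_right (abs_nonneg _) (hLle x)).trans ?_
        exact (hwlip t.1 h' h).trans h2.le)
    linarith
  refine ⟨fun h => ⟨q h, hqS h⟩, ?_, fun i => Subtype.ext (hqv i)⟩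
  have hcont' : Continuous fun h => (⟨q h, hqS h⟩ : S) := hcont.subtype_mk hqS
  exact (hcont'.isClosedEmbedding fun h h' heq => hinj (congrArg Subtype.val heq)).isEmbedding
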